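/- **Theorem.** Let $m$ be a non-negative integer, let $0<p\le 1$ be real, and assume that $p\le 1/2$ or $m\ge 4$. If a rate $R$ is achievable by proper $(2,m)$ CSS codes over the quantum erasure channel of erasure probability $p$, then $$R \;\le\; (1-2p)\Big(\frac{4}{mp}\big(1-(1-p)^m\,S_{m-2}\big(p(1-p)^{m-2}\big)\big)-1\Big),\qquad S_{m-2}(z)=\sum_{k=0}^{m-2}\frac{a_k}{k+1}z^k,$$ where $a_k$ is the number of subtrees with $k$ edges of the $m$-regular tree that contain a fixed vertex. Here a CSS code of length $n$ is given by two binary matrices $H_X$, $H_Z$ with $n$ columns such that $H_XH_Z^{T}=0$; its rate is $(n-\operatorname{rank}H_X-\operatorname{rank}H_Z)/n$. It is a $(2,m)$ CSS code if in each of $H_X$, $H_Z$ every row has weight $m$ and every column has weight $2$. Each of the two matrices is then the incidence matrix of a graph (vertices are the rows; each column is an edge joining the two rows in which it has a $1$), and the code is *proper* if both graphs are connected and have girth exactly $m$ (two parallel edges count as a cycle of length $2$; properness forces $m\ge 2$). Pauli errors up to phase are pairs $E=(E_X,E_Z)\in\mathbb F_2^n\times\mathbb F_2^n$, with syndrome $(H_XE_Z,\,H_ZE_X)$;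 the stabilizer group $S$ is the set of pairs with $E_X$ in the row space of $H_X$ and $E_Z$ in the row space of $H_Z$. Over the erasure channel each qubit is erased independently with probability $p$; given the set $\mathcal E$ of erased positions, the error $E$ is uniform among the $4^{|\mathcal E|}$ Pauli errors supported in $\mathcal E$. A decoder maps $\mathcal E$ and the syndrome of $E$ to a Pauli correction $\tilde E$, and fails if $\tilde E+E\notin S$. The rate $R$ is achievable by proper $(2,m)$ CSS codes if there is a sequence of such codes, with rates converging to $R$, and decoders for them whose failure probabilities tend to $0$. -/

import Mathlib

namespace CSSErasure

/-! ### Binary matrices of type `(2, m)` and their graphs -/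

/-- A binary matrix is of type `(2, m)` if every row has weight `m` and every column weight `2`. -/
def IsTwoType {r n : ℕ} (m : ℕ) (H : Matrix (Fin r) (Fin n) (ZMod 2)) : Prop :=
  (∀ i, hammingNorm (H i) = m) ∧ ∀ j, hammingNorm (fun i => H i j) = 2

/-- The (underlying simple graph of the) graph whose incidence matrix is `H`: the vertices are the
rows, and every column `j` is an edge joining the rows in which it has a `1`. -/
def rowGraph {r n : ℕ} (H : Matrix (Fin r) (Fin n) (ZMod 2)) : SimpleGraph (Fin r) where
  Adj i i' := i ≠ i' ∧ ∃ j, H i j = 1 ∧ H i' j = 1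
  symm := ⟨fun _ _ h => ⟨h.1.symm, h.2.imp fun _ hj => hj.symm⟩⟩
  loopless := ⟨fun _ h => h.1 rfl⟩

open Classical in
/-- The length of a shortest cycle (`⊤` if there is none) in the loopless multigraph with incidence
matrix `H`, whose edges are the columns of `H`. Two equal columns are parallel edges, that is, a
cycle of length `2`; without parallel edges the multigraph is the simple graph `rowGraph H`. -/
noncomputable def girth {r n : ℕ} (H : Matrix (Fin r) (Fin n) (ZMod 2)) : ℕ∞ :=
  if ∃ j j', j ≠ j' ∧ ∀ i, H i j = H i j' then 2 else (rowGraph H).egirth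

/-! ### CSS codes -/

/-- A CSS code, given by two binary matrices with mutually orthogonal rows. The rows of `HX` are
the stabilizer generators in `{I, X}^{⊗ n}`, those of `HZ` the generators in `{I, Z}^{⊗ n}`. -/
structure CSSCode where
  n : ℕ
  rX : ℕ
  rZ : ℕ
  HX : Matrix (Fin rX) (Fin n) (ZMod 2)
  HZ : Matrix (Fin rZ) (Fin n) (ZMod 2)
  orthogonal : HX * HZ.transpose = 0

/-- The Pauli group on `n` qubits modulo phases, as the `𝔽₂`-vector space `𝔽₂ⁿ × 𝔽₂ⁿ`. The element
`(a, b)` is the operator `∏ X_i ^ a_i Z_i ^ b_i`. -/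
abbrev Pauli (n : ℕ) : Type := (Fin n → ZMod 2) × (Fin n → ZMod 2)

/-- The error `E` acts as the identity outside of the set `e` of erased positions. -/
def Covers {n : ℕ} (e : Finset (Fin n)) (E : Pauli n) : Prop :=
  ∀ i, i ∉ e → E.1 i = 0 ∧ E.2 i = 0

namespace CSSCode

/-- A `(2, m)` CSS code. -/
def IsTwo (C : CSSCode) (m : ℕ) : Prop :=
  IsTwoType m C.HX ∧ IsTwoType m C.HZ

/-- A proper `(2, m)` CSS code: both graphs are connected and have girth `m`. -/
def IsProper (C : CSSCode) (m : ℕ) : Prop :=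
  C.IsTwo m ∧
    (rowGraph C.HX).Connected ∧ girth C.HX = (m : ℕ∞) ∧
    (rowGraph C.HZ).Connected ∧ girth C.HZ = (m : ℕ∞)

/-- The rate `k / n`, where `k = n - rank HX - rank HZ` is the number of encoded qubits. -/
noncomputable def rate (C : CSSCode) : ℝ :=
  ((C.n : ℝ) - (C.HX.rank : ℝ) - (C.HZ.rank : ℝ)) / (C.n : ℝ)

/-- The stabilizer group, generated by the rows of `HX` (as `X`-operators) and of `HZ` (as
`Z`-operators). -/
def stabilizer (C : CSSCode) : Submodule (ZMod 2) (Pauli C.n) :=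
  (Submodule.span (ZMod 2) (Set.range C.HX.row)).prod
    (Submodule.span (ZMod 2) (Set.range C.HZ.row))

/-- Values of the syndrome: one bit for every row of `HX` and of `HZ`. -/
abbrev Syn (C : CSSCode) : Type := (Fin C.rX → ZMod 2) × (Fin C.rZ → ZMod 2)

/-- The syndrome: an `X`-generator detects the `Z`-part of an error, a `Z`-generator the
`X`-part. -/
def syndrome (C : CSSCode) (E : Pauli C.n) : C.Syn :=
  (C.HX.mulVec E.2, C.HZ.mulVec E.1)

/-- A decoder proposes a Pauli correction from the erased positions and the measured syndrome. -/
abbrev Decoder (C : CSSCode) : Type := Finset (Fin C.n) → C.Syn → Pauli C.n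

open Classical in
/-- The decoding error probability of the decoder `D` over the quantum erasure channel: every
qubit is erased independently with probability `p`; given the set `e` of erased positions the
error `E` is uniform among the `4 ^ |e|` Pauli errors covered by `e`; and decoding fails if the
error and the correction are not in the same coset of the stabilizer group. -/
noncomputable def errorProb (C : CSSCode) (D : C.Decoder) (p : ℝ) : ℝ :=
  ∑ e : Finset (Fin C.n), p ^ e.card * (1 - p) ^ (C.n - e.card) *
    (((Finset.univ.filter fun E : Pauli C.n =>
        Covers e E ∧ D e (C.syndrome E) + E ∉ C.stabilizer).card : ℝ) / 4 ^ e.card)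

end CSSCode

/-- The rate `R` is achievable by proper `(2, m)` CSS codes over the quantum erasure channel of
erasure probability `p`: there is a sequence of such codes with rates converging to `R`, and of
decoders for them with vanishing error probability. -/
def Achievable (m : ℕ) (p R : ℝ) : Prop :=
  ∃ (C : ℕ → CSSCode) (D : ∀ t, (C t).Decoder),
    (∀ t, (C t).IsProper m) ∧
    Filter.Tendsto (fun t => (C t).rate) Filter.atTop (nhds R) ∧
    Filter.Tendsto (fun t => (C t).errorProb (D t) p) Filter.atTop (nhds 0)

/-! ### Subtrees of the regular tree -/

/-- Vertices of the `m`-regular tree: words over an alphabet of `m` letters in which consecutive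
letters are distinct. -/
abbrev TreeVertex (m : ℕ) : Type := {w : List (Fin m) // w.IsChain (· ≠ ·)}

/-- The `m`-regular tree: a word is joined to the words obtained by prepending a letter. -/
def regularTree (m : ℕ) : SimpleGraph (TreeVertex m) where
  Adj u v := (∃ c, v.1 = c :: u.1) ∨ ∃ c, u.1 = c :: v.1
  symm := ⟨fun _ _ h => h.symm⟩
  loopless := ⟨fun _ h => by rcases h with ⟨c, h⟩ | ⟨c, h⟩ <;> simp at h⟩

/-- The root of the tree: the empty word. -/
def treeRoot (m : ℕ) : TreeVertex m := ⟨[], List.isChain_nil⟩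

/-- The number `a_k` of subtrees with `k` edges of the `m`-regular tree that contain the root. -/
noncomputable def subtreeCount (m k : ℕ) : ℕ :=
  Set.ncard {T : (regularTree m).Subgraph |
    treeRoot m ∈ T.verts ∧ T.coe.IsTree ∧ T.edgeSet.encard = k}

/-- The truncated series `S_δ(z) = ∑_{k=0}^δ a_k z^k / (k+1)`. -/
noncomputable def truncatedSeries (m δ : ℕ) (z : ℝ) : ℝ :=
  ∑ k ∈ Finset.range (δ + 1), (subtreeCount m k : ℝ) / ((k : ℝ) + 1) * z ^ k

end CSSErasure

/-! Write ρ(e) for the sum of the ranks of the columns of `HX` and of `HZ` in the erased set e, and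
ρ(1) for its value on all columns, so that the code has dimension n - ρ(1). If e supports no
nontrivial logical operator, kernel vectors of one matrix supported in e lie in the row space of the
other. Comparing dimensions gives 2|e| + ρ(eᶜ) ≤ ρ(e) + ρ(1) (`Correctable.le_totalRank`). A decoder
fails with probability at least 1/2 on any other e, so this relation holds on average up to a
multiple of n times the error probability (`expected_rank_relation`).

Let ρ̄(p) be the mean of ρ over p-random sets. Rank is submodular, hence ρ̄ is concave
(`concaveOn_totalRank`). For p ≤ 1/2 the point 1 - p lies between p and 1, so concavity bounds ρ̄(1
- p) below by ρ̄(p) and ρ(1). Substitution leaves Rnp ≤ (1 - 2p)(ρ̄(p) - np) up to the error term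
(`IsProper.rate_le`).

It remains to bound ρ̄(p) above. The rank of a set of edges is at most the number r of vertices
minus the number of components, and that number is the sum over vertices of the inverse component
size. In girth m, the components with at most m - 2 edges that arise from subtrees of the universal
cover already contribute at least (1 - p)^m S to the mean inverse size
(`le_bernoulliSum_inv_card_component`). The two matrices together have 4n/m rows.

For p > 1/2 and m ≥ 4 the dimension is positive, and no cloning keeps the error probability at least
1/4 (`quarter_le_errorProb`), so no rate is achievable. -/

namespace CSSErasure

/-! ### Expectations over Bernoulli random subsets -/

section Bernoulli

variable {α : Type*}

/-- The expectation of `f` at a random subset of `s` that contains every element of `s`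
independently with probability `p`. -/
noncomputable def bernoulliSum (s : Finset α) (p : ℝ) (f : Finset α → ℝ) : ℝ :=
  ∑ e ∈ s.powerset, p ^ e.card * (1 - p) ^ (s.card - e.card) * f e

theorem bernoulliSum_congr {s : Finset α} {p : ℝ} {f g : Finset α → ℝ}
    (h : ∀ e ⊆ s, f e = g e) : bernoulliSum s p f = bernoulliSum s p g :=
  Finset.sum_congr rfl fun e he => by rw [h e (Finset.mem_powerset.1 he)]

theorem bernoulliSum_mono {s : Finset α} {p : ℝ} (h0 : 0 ≤ p) (h1 : p ≤ 1)
    {f g : Finset α → ℝ} (h : ∀ e, f e ≤ g e) : bernoulliSum s p f ≤ bernoulliSum s p g :=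
  Finset.sum_le_sum fun e _ => mul_le_mul_of_nonneg_left (h e)
    (mul_nonneg (pow_nonneg h0 _) (pow_nonneg (by linarith) _))

theorem bernoulliSum_add (s : Finset α) (p : ℝ) (f g : Finset α → ℝ) :
    bernoulliSum s p (fun e => f e + g e) = bernoulliSum s p f + bernoulliSum s p g := by
  simp only [bernoulliSum, mul_add, Finset.sum_add_distrib]

theorem bernoulliSum_sub (s : Finset α) (p : ℝ) (f g : Finset α → ℝ) :
    bernoulliSum s p (fun e => f e - g e) = bernoulliSum s p f - bernoulliSum s p g := by
  simp only [bernoulliSum, mul_sub, Finset.sum_sub_distrib]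

theorem bernoulliSum_const_mul (s : Finset α) (p c : ℝ) (f : Finset α → ℝ) :
    bernoulliSum s p (fun e => c * f e) = c * bernoulliSum s p f := by
  simp only [bernoulliSum, Finset.mul_sum]
  exact Finset.sum_congr rfl fun _ _ => by ring

theorem bernoulliSum_sum {ι : Type*} (s : Finset α) (p : ℝ) (t : Finset ι)
    (f : ι → Finset α → ℝ) :
    bernoulliSum s p (fun e => ∑ i ∈ t, f i e) = ∑ i ∈ t, bernoulliSum s p (f i) := by
  simp only [bernoulliSum, Finset.mul_sum]
  exact Finset.sum_comm

theorem bernoulliSum_const (s : Finset α) (p c : ℝ) : bernoulliSum s p (fun _ => c) = c := by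
  rw [bernoulliSum, ← Finset.sum_mul, Finset.sum_pow_mul_eq_add_pow]
  simp

theorem bernoulliSum_one_prob (s : Finset α) (f : Finset α → ℝ) : bernoulliSum s 1 f = f s := by
  rw [bernoulliSum, Finset.sum_eq_single s]
  · simp
  · intro e he hne
    have hlt : e.card < s.card :=
      Finset.card_lt_card (lt_of_le_of_ne (Finset.mem_powerset.1 he) hne)
    have : s.card - e.card ≠ 0 := by omega
    simp [this]
  · simp

theorem bernoulliSum_compl [Fintype α] [DecidableEq α] (p : ℝ) (f : Finset α → ℝ) :
    bernoulliSum Finset.univ p (fun e => f eᶜ) = bernoulliSum Finset.univ (1 - p) f := by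
  simp only [bernoulliSum, Finset.powerset_univ]
  refine Fintype.sum_equiv (Equiv.ofBijective _ compl_bijective) _ _ fun e => ?_
  have := Finset.card_le_univ e
  simp only [Equiv.ofBijective_apply, Finset.card_compl, Finset.card_univ, sub_sub_cancel]
  rw [Nat.sub_sub_self this]
  ring

/-- Conditioning on whether `a` is chosen. Monotonicity and concavity in `p` are proved by induction
along this recursion. -/
theorem bernoulliSum_insert [DecidableEq α] {a : α} {s : Finset α} (ha : a ∉ s) (p : ℝ)
    (f : Finset α → ℝ) :
    bernoulliSum (insert a s) p f =
      (1 - p) * bernoulliSum s p f + p * bernoulliSum s p (fun e => f (insert a e)) := by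
  simp only [bernoulliSum]
  rw [Finset.sum_powerset_insert ha, Finset.mul_sum, Finset.mul_sum]
  congr 1
  · refine Finset.sum_congr rfl fun e he => ?_
    have := Finset.card_le_card (Finset.mem_powerset.1 he)
    rw [Finset.card_insert_of_notMem ha, Nat.sub_add_comm this, pow_succ]
    ring
  · refine Finset.sum_congr rfl fun e he => ?_
    have hae : a ∉ e := fun h => ha (Finset.mem_powerset.1 he h)
    rw [Finset.card_insert_of_notMem ha, Finset.card_insert_of_notMem hae, pow_succ,
      Nat.add_sub_add_right]
    ring

theorem bernoulliSum_card (s : Finset α) (p : ℝ) :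
    bernoulliSum s p (fun e => (e.card : ℝ)) = s.card * p := by
  classical
  induction s using Finset.induction_on with
  | empty => simp [bernoulliSum]
  | insert a s ha ih =>
    rw [bernoulliSum_insert ha, bernoulliSum_congr (f := fun e => ((insert a e).card : ℝ))
      (g := fun e => (e.card : ℝ) + 1), bernoulliSum_add, bernoulliSum_const, ih,
      Finset.card_insert_of_notMem ha]
    · push_cast; ring
    · intro e he
      rw [Finset.card_insert_of_notMem fun h => ha (he h)]
      push_cast; ring

/-- The expectation of a decreasing function of the random set decreases with the probability. -/
theorem antitoneOn_bernoulliSum (s : Finset α) {f : Finset α → ℝ} (hf : Antitone f) :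
    AntitoneOn (fun p => bernoulliSum s p f) (Set.Icc 0 1) := by
  classical
  induction s using Finset.induction_on generalizing f with
  | empty => intro p _ q _ _; simp [bernoulliSum]
  | insert a s ha ih =>
    intro p hp q hq hpq
    have h0 := ih hf hp hq hpq
    have h1 := ih (f := fun e => f (insert a e))
      (fun e e' h => hf (Finset.insert_subset_insert a h)) hp hq hpq
    have h2 : bernoulliSum s p (fun e => f (insert a e)) ≤ bernoulliSum s p f :=
      bernoulliSum_mono hp.1 hp.2 fun e => hf (Finset.subset_insert a e)
    simp only [bernoulliSum_insert ha] at h0 h1 ⊢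
    nlinarith [mul_le_mul_of_nonneg_left h0 (sub_nonneg.2 hq.2),
      mul_le_mul_of_nonneg_left h1 hq.1, mul_nonneg (sub_nonneg.2 hpq) (sub_nonneg.2 h2)]

/-- The expectation of a function with decreasing increments is concave in the probability. -/
theorem concaveOn_bernoulliSum [DecidableEq α] (s : Finset α) {f : Finset α → ℝ}
    (hf : ∀ a, Antitone fun e => f (insert a e) - f e) :
    ConcaveOn ℝ (Set.Icc 0 1) (fun p => bernoulliSum s p f) := by
  induction s using Finset.induction_on generalizing f with
  | empty =>
    simp only [bernoulliSum, Finset.powerset_empty, Finset.sum_singleton]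
    simpa using concaveOn_const _ (convex_Icc _ _)
  | insert a s ha ih =>
    refine ⟨convex_Icc _ _, ?_⟩
    have h0 := (ih hf).2
    have h1 := (ih (f := fun e => f (insert a e)) fun b e e' h => by
      have := hf b (Finset.insert_subset_insert a h)
      simpa only [Finset.insert_comm a b] using this).2
    have hD := antitoneOn_bernoulliSum s (hf a)
    simp only [bernoulliSum_sub] at hD
    -- With A, B the means without and with `a`, and t = ux + vy, the product rule leaves the excess
    -- uv(y - x)((B - A)(x) - (B - A)(y)). It is nonnegative because B - A is antitone.
    have key : ∀ x ∈ Set.Icc (0 : ℝ) 1, ∀ y ∈ Set.Icc (0 : ℝ) 1,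
        0 ≤ (y - x) * ((bernoulliSum s x (fun e => f (insert a e)) - bernoulliSum s x f) -
          (bernoulliSum s y (fun e => f (insert a e)) - bernoulliSum s y f)) := by
      intro x hx y hy
      rcases le_total x y with h | h
      · exact mul_nonneg (sub_nonneg.2 h) (sub_nonneg.2 (hD hx hy h))
      · exact mul_nonneg_of_nonpos_of_nonpos (sub_nonpos.2 h) (sub_nonpos.2 (hD hy hx h))
    intro x hx y hy u v hu hv huv
    have hxy := convex_Icc (0 : ℝ) 1 hx hy hu hv huv
    have h0 := mul_le_mul_of_nonneg_left (h0 hx hy hu hv huv) (sub_nonneg.2 hxy.2)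
    have h1 := mul_le_mul_of_nonneg_left (h1 hx hy hu hv huv) hxy.1
    have h2 := mul_nonneg (mul_nonneg hu hv) (key x hx y hy)
    simp only [bernoulliSum_insert ha, smul_eq_mul] at h0 h1 h2 ⊢
    obtain rfl : v = 1 - u := by linarith
    nlinarith [h0, h1, h2]

/-- The probability that a random subset contains `F` and avoids `B`. -/
theorem bernoulliSum_contains_avoids [Fintype α] [DecidableEq α] (p : ℝ) {F B : Finset α}
    (hFB : Disjoint F B) :
    bernoulliSum Finset.univ p (fun e => if F ⊆ e ∧ Disjoint B e then 1 else 0) =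
      p ^ F.card * (1 - p) ^ B.card := by
  -- In the expansion over subsets `e`, the zeros kill exactly the terms where `e` meets `B` or
  -- misses part of `F`.
  have h := Finset.prod_add (fun i => if i ∈ B then (0 : ℝ) else p)
    (fun i => if i ∈ F then (0 : ℝ) else 1 - p) Finset.univ
  have hl : ∏ i, ((if i ∈ B then (0 : ℝ) else p) + if i ∈ F then (0 : ℝ) else 1 - p) =
      p ^ F.card * (1 - p) ^ B.card := by
    have : ∀ i, ((if i ∈ B then (0 : ℝ) else p) + if i ∈ F then (0 : ℝ) else 1 - p) =
        (if i ∈ F then p else 1) * (if i ∈ B then 1 - p else 1) := by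
      intro i
      have : i ∈ F → i ∉ B := fun h => Finset.disjoint_left.1 hFB h
      by_cases h1 : i ∈ F <;> by_cases h2 : i ∈ B <;> simp_all
    simp only [this, Finset.prod_mul_distrib, Finset.prod_ite_mem, Finset.univ_inter,
      Finset.prod_const]
  rw [← hl, h, bernoulliSum]
  refine Finset.sum_congr rfl fun e _ => ?_
  by_cases h1 : F ⊆ e
  · by_cases h2 : Disjoint B e
    · rw [Finset.prod_congr rfl (g := fun _ => p), Finset.prod_congr (s₁ := Finset.univ \ e) rfl
        (g := fun _ => 1 - p)]
      · simp [h1, h2, Finset.card_sdiff_of_subset]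
      · intro i hi
        rw [if_neg fun hF => (Finset.mem_sdiff.1 hi).2 (h1 hF)]
      · intro i hi
        rw [if_neg fun hB => Finset.disjoint_left.1 h2 hB hi]
    · obtain ⟨i, hB, he⟩ := Finset.not_disjoint_iff.1 h2
      rw [Finset.prod_eq_zero he (by simp [hB])]
      simp [h2]
  · obtain ⟨i, hF, he⟩ := Finset.not_subset.1 h1
    rw [Finset.prod_eq_zero (i := i) (s := Finset.univ \ e) (by simpa using he) (by simp [hF])]
    simp [h1]

end Bernoulli

/-! ### Ranks of sets of columns -/

section Rank

variable {K : Type*} [Field K] {r n : ℕ} (H : Matrix (Fin r) (Fin n) K)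

/-- The rank of the columns of `H` with index in `e`. -/
noncomputable def colRank (e : Finset (Fin n)) : ℕ :=
  Module.finrank K (Submodule.span K (H.col '' e))

/-- The vectors orthogonal to the columns of `H` with index in `e`. -/
def leftKer (e : Finset (Fin n)) : Submodule K (Fin r → K) where
  carrier := {y | ∀ j ∈ e, y ⬝ᵥ H.col j = 0}
  add_mem' hx hy j hj := by rw [add_dotProduct, hx j hj, hy j hj, add_zero]
  zero_mem' j _ := zero_dotProduct _
  smul_mem' c x hx j hj := by rw [smul_dotProduct, hx j hj, smul_zero]

theorem mem_leftKer {e : Finset (Fin n)} {y : Fin r → K} :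
    y ∈ leftKer H e ↔ ∀ j ∈ e, y ⬝ᵥ H.col j = 0 := Iff.rfl

theorem leftKer_anti {e e' : Finset (Fin n)} (h : e ⊆ e') : leftKer H e' ≤ leftKer H e :=
  fun _ hy j hj => hy j (h hj)

theorem colRank_mono {e e' : Finset (Fin n)} (h : e ⊆ e') : colRank H e ≤ colRank H e' :=
  Submodule.finrank_mono (Submodule.span_mono (Set.image_mono (Finset.coe_subset.2 h)))

theorem colRank_univ : colRank H Finset.univ = H.rank := by
  rw [colRank, Matrix.rank_eq_finrank_span_cols, Finset.coe_univ, Set.image_univ]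

theorem rank_submatrix_cols (e : Finset (Fin n)) :
    (H.submatrix id (Subtype.val : e → Fin n)).rank = colRank H e := by
  rw [colRank, Matrix.rank_eq_finrank_span_cols]
  have : Set.range (H.submatrix id (Subtype.val : e → Fin n)).col = H.col '' e := by
    ext y
    constructor
    · rintro ⟨j, rfl⟩
      exact ⟨j, j.2, rfl⟩
    · rintro ⟨j, hj, rfl⟩
      exact ⟨⟨j, hj⟩, rfl⟩
  rw [this]

theorem colRank_add_finrank_leftKer (e : Finset (Fin n)) :
    colRank H e + Module.finrank K (leftKer H e) = r := by
  have h := LinearMap.finrank_range_add_finrank_ker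
    (H.submatrix id (Subtype.val : e → Fin n)).transpose.mulVecLin
  rw [Module.finrank_fin_fun] at h
  rw [← rank_submatrix_cols, ← Matrix.rank_transpose, Matrix.rank]
  have hker : leftKer H e = LinearMap.ker
      (H.submatrix id (Subtype.val : e → Fin n)).transpose.mulVecLin := by
    ext y
    simp only [mem_leftKer, LinearMap.mem_ker, Matrix.mulVecLin_apply, funext_iff, Subtype.forall]
    refine forall₂_congr fun j hj => ?_
    rw [dotProduct_comm]
    rfl
  rw [hker]
  exact h

/-- Submodularity of rank: the spans over `insert a e` and `e'` together span the columns in `insert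
a e'`, and their intersection contains the span over `e`. -/
theorem colRank_insert_sub_antitone (a : Fin n) :
    Antitone fun e : Finset (Fin n) => (colRank H (insert a e) : ℝ) - colRank H e := by
  intro e e' h
  have h1 := Submodule.finrank_sup_add_finrank_inf_eq
    (Submodule.span K (H.col '' (insert a e : Finset (Fin n))))
    (Submodule.span K (H.col '' e'))
  rw [← Submodule.span_union, ← Set.image_union, ← Finset.coe_union, Finset.insert_union,
    Finset.union_eq_right.2 h] at h1
  have h2 : colRank H e ≤ Module.finrank K
      (Submodule.span K (H.col '' (insert a e : Finset (Fin n))) ⊓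
        Submodule.span K (H.col '' e') : Submodule K (Fin r → K)) :=
    Submodule.finrank_mono (le_inf
      (Submodule.span_mono (Set.image_mono (Finset.coe_subset.2 (Finset.subset_insert a e))))
      (Submodule.span_mono (Set.image_mono (Finset.coe_subset.2 h))))
  have h3 : colRank H (insert a e') + colRank H e ≤ colRank H (insert a e) + colRank H e' :=
    (Nat.add_le_add_left h2 _).trans h1.le
  have h4 : (colRank H (insert a e') : ℝ) + colRank H e ≤ colRank H (insert a e) + colRank H e' :=
    by exact_mod_cast h3
  simp only
  linarith

/-- If every vector of the kernel of `H` supported in `e` is a sum of rows of `H'`, then the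
ranks of the columns inside and outside of `e` are related. -/
theorem card_add_colRank_compl_le {r' : ℕ} (H' : Matrix (Fin r') (Fin n) K)
    {e : Finset (Fin n)}
    (h : ∀ x : Fin n → K, (∀ i ∉ e, x i = 0) → H.mulVec x = 0 →
      x ∈ Submodule.span K (Set.range H'.row)) :
    e.card + colRank H' eᶜ ≤ colRank H e + H'.rank := by
  let M := H.submatrix id (Subtype.val : e → Fin n)
  -- The range of `f` consists of the row space vectors of `H'` supported in `e`; by `h` it contains
  -- the kernel of `M`, extended by zero.
  let f := H'.vecMulLinear.domRestrict (leftKer H' eᶜ)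
  let ι := Function.ExtendByZero.linearMap K (Subtype.val : e → Fin n)
  have hι : Function.Injective ι := fun x y hxy => by
    funext i
    have := congrFun hxy i
    rwa [Function.ExtendByZero.linearMap_apply, Function.ExtendByZero.linearMap_apply,
      Subtype.val_injective.extend_apply, Subtype.val_injective.extend_apply] at this
  have hM : M.mulVecLin = H.mulVecLin ∘ₗ ι := by
    refine LinearMap.ext fun x => funext fun i => ?_
    simp only [Matrix.mulVecLin_apply, LinearMap.comp_apply, Matrix.mulVec, dotProduct]
    rw [← Finset.sum_subset (Finset.subset_univ e), ← Finset.sum_coe_sort e]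
    · refine Finset.sum_congr rfl fun j _ => ?_
      simp [M, ι]
    · intro j _ hj
      have : ι x j = 0 := Function.extend_apply' _ _ _ (by rintro ⟨k, rfl⟩; exact hj k.2)
      rw [this, mul_zero]
  have hle : (LinearMap.ker M.mulVecLin).map ι ≤ LinearMap.range f := by
    rintro _ ⟨x, hx, rfl⟩
    have h0 : ∀ i ∉ e, ι x i = 0 := fun i hi =>
      Function.extend_apply' _ _ _ (by rintro ⟨k, rfl⟩; exact hi k.2)
    have h1 : H.mulVec (ι x) = 0 := by
      have : M.mulVecLin x = 0 := hx
      rwa [hM] at this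
    have h2 := h _ h0 h1
    rw [← range_vecMulLinear] at h2
    obtain ⟨y, hy⟩ := h2
    refine ⟨⟨y, fun j hj => ?_⟩, hy⟩
    have := congrFun hy j
    rw [h0 j (Finset.mem_compl.1 hj)] at this
    exact this
  have h1 := Submodule.finrank_mono hle
  rw [← (Submodule.equivMapOfInjective ι hι _).finrank_eq] at h1
  have h2 := LinearMap.finrank_range_add_finrank_ker M.mulVecLin
  have h3 := LinearMap.finrank_range_add_finrank_ker f
  -- This gives `f` rank (r' - colRank H' eᶜ) - (r' - rank H'), while the kernel of `M` has
  -- dimension |e| - colRank H e.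
  have h4 : Module.finrank K (LinearMap.ker f) =
      Module.finrank K (leftKer H' Finset.univ) := by
    have : LinearMap.ker f =
        (leftKer H' Finset.univ).comap (leftKer H' eᶜ).subtype := by
      ext y
      simp only [LinearMap.mem_ker, Submodule.mem_comap, mem_leftKer, f,
        LinearMap.domRestrict_apply, Finset.mem_univ, true_imp_iff, funext_iff]
      rfl
    rw [this, (Submodule.comapSubtypeEquivOfLe
      (leftKer_anti H' (Finset.subset_univ eᶜ))).finrank_eq]
  have h5 := colRank_add_finrank_leftKer H' eᶜ
  have h6 := colRank_add_finrank_leftKer H' Finset.univ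
  have h7 : Module.finrank K (LinearMap.range M.mulVecLin) = colRank H e :=
    rank_submatrix_cols H e
  rw [Module.finrank_fintype_fun_eq_card, Fintype.card_coe] at h2
  rw [colRank_univ] at h6
  omega

end Rank

/-! ### Correctable erasures -/

namespace CSSCode

variable (C : CSSCode)

/-- The erasure pattern `e` is correctable: it supports no nontrivial logical operator. -/
def Correctable (e : Finset (Fin C.n)) : Prop :=
  ∀ E : Pauli C.n, Covers e E → C.syndrome E = 0 → E ∈ C.stabilizer

/-- The total rank of the columns of both matrices with index in `e`. -/
noncomputable def totalRank (e : Finset (Fin C.n)) : ℕ := colRank C.HX e + colRank C.HZ e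

theorem Correctable.anti {C : CSSCode} {e e' : Finset (Fin C.n)} (h : e ⊆ e')
    (he : C.Correctable e') : C.Correctable e :=
  fun E hE hs => he E (fun i hi => hE i fun hi' => hi (h hi')) hs

/-- Pure Z-errors and pure X-errors give one inequality each, with the roles of the two matrices
exchanged. -/
theorem Correctable.le_totalRank {C : CSSCode} {e : Finset (Fin C.n)} (h : C.Correctable e) :
    2 * e.card + C.totalRank eᶜ ≤ C.totalRank e + C.totalRank Finset.univ := by
  have h1 := card_add_colRank_compl_le C.HX C.HZ (e := e) fun x hx h0 =>
    (h (0, x) (fun i hi => ⟨rfl, hx i hi⟩)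
      (Prod.ext h0 (Matrix.mulVec_zero C.HZ))).2
  have h2 := card_add_colRank_compl_le C.HZ C.HX (e := e) fun x hx h0 =>
    (h (x, 0) (fun i hi => ⟨hx i hi, rfl⟩)
      (Prod.ext (Matrix.mulVec_zero C.HX) h0)).1
  simp only [totalRank, colRank_univ]
  omega

theorem card_filter_covers {n : ℕ} (e : Finset (Fin n)) [DecidablePred (Covers e)] :
    (Finset.univ.filter fun E : Pauli n => Covers e E).card = 4 ^ e.card := by
  classical
  have h1 : (Finset.univ.filter fun E : Pauli n => Covers e E) =
      (Fintype.piFinset fun i => if i ∈ e then (Finset.univ : Finset (ZMod 2)) else {0}) ×ˢ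
        (Fintype.piFinset fun i => if i ∈ e then (Finset.univ : Finset (ZMod 2)) else {0}) := by
    ext E
    simp only [Finset.mem_filter, Finset.mem_univ, true_and, Finset.mem_product,
      Fintype.mem_piFinset, ← forall_and]
    change (∀ i ∉ e, E.1 i = 0 ∧ E.2 i = 0) ↔ _
    refine forall_congr' fun i => ?_
    by_cases hi : i ∈ e <;> simp [hi]
  have h2 : ∀ i, (if i ∈ e then (Finset.univ : Finset (ZMod 2)) else {0}).card =
      if i ∈ e then 2 else 1 := by
    intro i
    split_ifs
    · rfl
    · rfl
  rw [h1, Finset.card_product, Fintype.card_piFinset]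
  simp only [h2, Finset.prod_ite_mem, Finset.univ_inter, Finset.prod_const]
  rw [← mul_pow]
  norm_num

open Classical in
/-- A decoder fails with probability at least `1 / 2` on an erasure that is not correctable. -/
theorem card_covers_le_two_mul_card_failures (D : C.Decoder) {e : Finset (Fin C.n)}
    (h : ¬ C.Correctable e) :
    4 ^ e.card ≤ 2 * (Finset.univ.filter fun E : Pauli C.n =>
        Covers e E ∧ D e (C.syndrome E) + E ∉ C.stabilizer).card := by
  simp only [Correctable, not_forall] at h
  obtain ⟨L, hL, hL0, hLS⟩ := h
  have hsyn : ∀ E, C.syndrome (E + L) = C.syndrome E := by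
    intro E
    have h1 : C.HX.mulVec L.2 = 0 := congrArg Prod.fst hL0
    have h2 : C.HZ.mulVec L.1 = 0 := congrArg Prod.snd hL0
    simp [syndrome, Matrix.mulVec_add, h1, h2]
  rw [← card_filter_covers, ← Finset.card_filter_add_card_filter_not
    (s := Finset.univ.filter fun E : Pauli C.n => Covers e E)
    (fun E => D e (C.syndrome E) + E ∉ C.stabilizer), Finset.filter_filter,
    Finset.filter_filter, two_mul]
  -- Translation by the nontrivial logical operator `L` preserves support and syndrome, hence also
  -- the correction, and so turns every success into a failure.
  refine Nat.add_le_add_left (Finset.card_le_card_of_injOn (· + L) ?_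
    (add_left_injective L).injOn) _
  intro E hE
  simp only [Finset.coe_filter, Finset.mem_univ, true_and, Set.mem_ofPred_eq, not_not] at hE ⊢
  refine ⟨fun i hi => ?_, ?_⟩
  · simp [hE.1 i hi, hL i hi]
  · rw [hsyn, ← add_assoc]
    exact fun h => hLS ((Submodule.add_mem_iff_right _ hE.2).1 h)

open Classical in
/-- The probability that the erasure is not correctable is at most twice the decoding error
probability. -/
theorem bernoulliSum_not_correctable_le (D : C.Decoder) {p : ℝ} (h0 : 0 ≤ p) (h1 : p ≤ 1) :
    bernoulliSum Finset.univ p (fun e => if C.Correctable e then 0 else 1) ≤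
      2 * C.errorProb D p := by
  rw [errorProb, bernoulliSum, Finset.powerset_univ, Finset.mul_sum]
  refine Finset.sum_le_sum fun e _ => ?_
  rw [Finset.card_univ, Fintype.card_fin, mul_left_comm]
  refine mul_le_mul_of_nonneg_left ?_ (mul_nonneg (pow_nonneg h0 _) (pow_nonneg (by linarith) _))
  split_ifs with h
  · positivity
  · rw [← mul_div_assoc, le_div_iff₀ (by positivity), one_mul]
    exact_mod_cast C.card_covers_le_two_mul_card_failures D h

end CSSCode

/-! ### The regular tree -/

section Tree

variable {m : ℕ}

/-- The neighbour of the vertex `u` of the regular tree along the edge of colour `c`: the letter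
`c` is prepended or, if `u` starts with `c`, deleted. -/
def treeNeighbor (u : TreeVertex m) (c : Fin m) : TreeVertex m :=
  match u with
  | ⟨[], _⟩ => ⟨[c], List.isChain_singleton c⟩
  | ⟨d :: l, h⟩ => if hc : c = d then ⟨l, h.tail⟩
    else ⟨c :: d :: l, List.isChain_cons_cons.2 ⟨hc, h⟩⟩

theorem treeNeighbor_cases (u : TreeVertex m) (c : Fin m) :
    (treeNeighbor u c).1 = c :: u.1 ∨ u.1 = c :: (treeNeighbor u c).1 := by
  obtain ⟨_ | ⟨d, l⟩, h⟩ := u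
  · exact Or.inl rfl
  · by_cases hc : c = d
    · subst hc
      simp [treeNeighbor]
    · simp [treeNeighbor, hc]

theorem treeNeighbor_of_eq_cons {u v : TreeVertex m} {c : Fin m} (h : v.1 = c :: u.1) :
    treeNeighbor u c = v := by
  obtain ⟨_ | ⟨d, l⟩, hu⟩ := u
  · exact Subtype.ext h.symm
  · have hv := v.2
    rw [h] at hv
    exact Subtype.ext (by simp [treeNeighbor, (List.isChain_cons_cons.1 hv).1, h])

theorem treeNeighbor_of_cons_eq {u v : TreeVertex m} {c : Fin m} (h : u.1 = c :: v.1) :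
    treeNeighbor u c = v := by
  obtain ⟨u, hu⟩ := u
  subst h
  simp [treeNeighbor]

theorem regularTree_adj_iff {u v : TreeVertex m} :
    (regularTree m).Adj u v ↔ ∃ c, treeNeighbor u c = v := by
  constructor
  · rintro (⟨c, h⟩ | ⟨c, h⟩)
    · exact ⟨c, treeNeighbor_of_eq_cons h⟩
    · exact ⟨c, treeNeighbor_of_cons_eq h⟩
  · rintro ⟨c, rfl⟩
    exact (treeNeighbor_cases u c).imp (⟨c, ·⟩) (⟨c, ·⟩)

theorem treeNeighbor_treeNeighbor (u : TreeVertex m) (c : Fin m) :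
    treeNeighbor (treeNeighbor u c) c = u := by
  rcases treeNeighbor_cases u c with h | h
  · exact treeNeighbor_of_cons_eq h
  · exact treeNeighbor_of_eq_cons h

variable {T : (regularTree m).Subgraph} {k : ℕ}

theorem finite_verts_of_isTree (hT : T.coe.IsTree) (hk : T.edgeSet.encard = k)
    {v : TreeVertex m} (hv : v ∈ T.verts) : T.verts.Finite := by
  have hfin : T.edgeSet.Finite := Set.finite_of_encard_eq_coe hk
  refine ((Set.finite_singleton v).union
    (hfin.biUnion fun e _ => (e.toFinset).finite_toSet)).subset ?_
  intro x hx
  by_cases hxv : x = v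
  · exact Or.inl hxv
  · obtain ⟨w⟩ := hT.1.1 ⟨x, hx⟩ ⟨v, hv⟩
    cases w with
    | nil => exact absurd rfl hxv
    | @cons _ y _ h _ =>
      refine Or.inr (Set.mem_biUnion (x := s(x, y.1)) (SimpleGraph.Subgraph.mem_edgeSet.2 h) ?_)
      simp

theorem natCard_edgeSet_coe (hk : T.edgeSet.encard = k) : Nat.card T.coe.edgeSet = k := by
  rw [← SimpleGraph.Subgraph.image_coe_edgeSet_coe,
    (Sym2.map.injective Subtype.val_injective).encard_image] at hk
  rw [Nat.card_coe_set_eq, Set.ncard, hk, ENat.toNat_natCast]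

theorem natCard_verts_of_isTree (hT : T.coe.IsTree) (hk : T.edgeSet.encard = k)
    {v : TreeVertex m} (hv : v ∈ T.verts) : Nat.card T.verts = k + 1 := by
  have := (finite_verts_of_isTree hT hk hv).to_subtype
  rw [← natCard_edgeSet_coe hk]
  exact (SimpleGraph.isTree_iff_connected_and_card.1 hT).2.symm

theorem exists_verts_finset (hT : T.coe.IsTree) (hk : T.edgeSet.encard = k)
    {v : TreeVertex m} (hv : v ∈ T.verts) :
    ∃ V : Finset (TreeVertex m), (∀ x, x ∈ V ↔ x ∈ T.verts) ∧ V.card = k + 1 := by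
  refine ⟨(finite_verts_of_isTree hT hk hv).toFinset, fun x => Set.Finite.mem_toFinset _, ?_⟩
  rw [← natCard_verts_of_isTree hT hk hv, Nat.card_coe_set_eq,
    Set.ncard_eq_toFinset_card _ (finite_verts_of_isTree hT hk hv)]

/-- Any two vertices of a subtree with `k` edges are joined by a path of length at most `k`. -/
theorem exists_isPath_length_le (hT : T.coe.IsTree) (hk : T.edgeSet.encard = k)
    {u v : TreeVertex m} (hu : u ∈ T.verts) (hv : v ∈ T.verts) :
    ∃ p : (regularTree m).Walk u v, p.IsPath ∧ p.length ≤ k := by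
  have := (finite_verts_of_isTree hT hk hv).fintype
  obtain ⟨p, hp, -⟩ := hT.existsUnique_path ⟨u, hu⟩ ⟨v, hv⟩
  refine ⟨p.map T.hom, hp.map T.hom_injective, ?_⟩
  have h := hp.length_lt
  rw [← Nat.card_eq_fintype_card, natCard_verts_of_isTree hT hk hv] at h
  exact (SimpleGraph.Walk.length_map _ _).trans_le (Nat.lt_succ_iff.1 h)

open Classical in
/-- A subtree with `k` edges contains at least `2 * k` half-edges. -/
theorem two_mul_le_card_halfEdges (hT : T.coe.IsTree) (hk : T.edgeSet.encard = k)
    {V : Finset (TreeVertex m)} (hV : ∀ x, x ∈ V ↔ x ∈ T.verts) {v : TreeVertex m}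
    (hv : v ∈ T.verts) :
    2 * k ≤ ((V ×ˢ (Finset.univ : Finset (Fin m))).filter
      fun x => T.Adj x.1 (treeNeighbor x.1 x.2)).card := by
  have := (finite_verts_of_isTree hT hk hv).fintype
  have hd := T.coe.dart_card_eq_twice_card_edges
  rw [SimpleGraph.edgeFinset_card, ← Nat.card_eq_fintype_card (α := T.coe.edgeSet),
    natCard_edgeSet_coe hk] at hd
  rw [← hd, ← Finset.card_univ]
  have hc : ∀ d : T.coe.Dart, ∃ c, treeNeighbor d.fst.1 c = d.snd.1 := fun d =>
    regularTree_adj_iff.1 (T.adj_sub d.adj)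
  choose c hc using hc
  refine Finset.card_le_card_of_injOn (fun d => (d.fst.1, c d)) ?_ ?_
  · intro d _
    simp only [Finset.coe_filter, Set.mem_ofPred_eq, Finset.mem_product, Finset.mem_univ,
      and_true, hV, hc]
    exact ⟨d.fst.2, d.adj⟩
  · intro d _ d' _ h
    obtain ⟨h1, h2⟩ := Prod.mk.inj h
    have h3 : d.snd.1 = d'.snd.1 := by rw [← hc, ← hc, h1, h2]
    exact SimpleGraph.Dart.ext _ _ (Prod.ext (Subtype.ext h1) (Subtype.ext h3))

end Tree

/-! ### The graph of a matrix of type `(2, m)` and its universal cover -/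

section Cover

variable {m r n : ℕ} {H : Matrix (Fin r) (Fin n) (ZMod 2)}

theorem eq_one_of_ne_zero {a : ZMod 2} (h : a ≠ 0) : a = 1 := by
  revert a
  decide

theorem IsTwoType.exists_ends (hH : IsTwoType m H) (j : Fin n) :
    ∃ a b, a ≠ b ∧ ∀ i, H i j = if i = a ∨ i = b then 1 else 0 := by
  obtain ⟨a, b, hab, h⟩ := Finset.card_eq_two.1 (hH.2 j)
  refine ⟨a, b, hab, fun i => ?_⟩
  have hi := Finset.ext_iff.1 h i
  simp only [Finset.mem_filter, Finset.mem_univ, true_and, Finset.mem_insert,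
    Finset.mem_singleton] at hi
  split_ifs with hc
  · exact eq_one_of_ne_zero (hi.2 hc)
  · exact not_not.1 fun h0 => hc (hi.1 h0)

theorem IsTwoType.exists_otherEnd (hH : IsTwoType m H) (x : Fin r) (j : Fin n) :
    ∃ y, y ≠ x ∧ H y j = 1 := by
  obtain ⟨a, b, hab, h⟩ := hH.exists_ends j
  by_cases hxa : x = a
  · exact ⟨b, fun hb => hab (hxa.symm.trans hb.symm), by simp [h]⟩
  · exact ⟨a, Ne.symm hxa, by simp [h]⟩

theorem IsTwoType.eq_or_eq (hH : IsTwoType m H) {x y z : Fin r} {j : Fin n} (hxy : x ≠ y)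
    (hx : H x j = 1) (hy : H y j = 1) (hz : H z j = 1) : z = x ∨ z = y := by
  obtain ⟨a, b, hab, h⟩ := hH.exists_ends j
  simp only [h, ite_eq_left_iff, zero_ne_one, imp_false, not_not] at hx hy hz
  grind

/-- Columns with the same ends are equal. -/
theorem IsTwoType.col_eq (hH : IsTwoType m H) {x y : Fin r} {j j' : Fin n} (hxy : x ≠ y)
    (hx : H x j = 1) (hy : H y j = 1) (hx' : H x j' = 1) (hy' : H y j' = 1) (i : Fin r) :
    H i j = H i j' := by
  by_cases hi : H i j = 0
  · by_cases hi' : H i j' = 0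
    · rw [hi, hi']
    · rcases hH.eq_or_eq hxy hx' hy' (eq_one_of_ne_zero hi') with rfl | rfl
      · rw [hx, hx']
      · rw [hy, hy']
  · rcases hH.eq_or_eq hxy hx hy (eq_one_of_ne_zero hi) with rfl | rfl
    · rw [hx, hx']
    · rw [hy, hy']

theorem IsTwoType.exists_frame (hH : IsTwoType m H) (x : Fin r) :
    ∃ σ : Fin m → Fin n, Function.Injective σ ∧ ∀ j, H x j = 1 ↔ ∃ c, σ c = j := by
  let σ := (Finset.equivFinOfCardEq (hH.1 x)).symm
  refine ⟨fun c => (σ c).1, Subtype.val_injective.comp σ.injective, fun j => ⟨fun hj => ?_, ?_⟩⟩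
  · exact ⟨σ.symm ⟨j, by simp [hj]⟩, by simp⟩
  · rintro ⟨c, rfl⟩
    exact eq_one_of_ne_zero (Finset.mem_filter.1 (σ c).2).2

/-- A transposition of colours gives column `j` the prescribed colour, so that a lifted edge can
have the same colour at both ends. -/
theorem IsTwoType.exists_frame_apply (hH : IsTwoType m H) {x : Fin r} {j : Fin n} (hj : H x j = 1)
    (c : Fin m) :
    ∃ σ : Fin m → Fin n,
      (Function.Injective σ ∧ ∀ j, H x j = 1 ↔ ∃ c, σ c = j) ∧ σ c = j := by
  obtain ⟨σ, hσ, h⟩ := hH.exists_frame x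
  obtain ⟨d, rfl⟩ := (h j).1 hj
  refine ⟨σ ∘ Equiv.swap c d, ⟨hσ.comp (Equiv.injective _), fun j => (h j).trans ?_⟩, by simp⟩
  exact ⟨fun ⟨c', hc'⟩ => ⟨Equiv.swap c d c', by simp [hc']⟩, fun ⟨c', hc'⟩ => ⟨_, hc'⟩⟩

/-- A covering of the graph of `H` by the `m`-regular tree, extended to all words. -/
structure TreeCover (m : ℕ) (H : Matrix (Fin r) (Fin n) (ZMod 2)) (v : Fin r) where
  /-- The vertex below a vertex of the tree. -/
  vert : List (Fin m) → Fin r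
  /-- The column below the edge of a given colour at a vertex of the tree. -/
  edge : List (Fin m) → Fin m → Fin n
  vert_nil : vert [] = v
  edge_injective : ∀ w, Function.Injective (edge w)
  incident_iff : ∀ w j, H (vert w) j = 1 ↔ ∃ c, edge w c = j
  vert_cons_ne : ∀ c w, vert (c :: w) ≠ vert w
  edge_cons : ∀ c w, edge (c :: w) c = edge w c

/-- Recursion on the word: colour `c` leads to the other end of its column, where a numbering that
again gives this column colour `c` is chosen. -/
theorem IsTwoType.nonempty_treeCover (hH : IsTwoType m H) (v : Fin r) :
    Nonempty (TreeCover m H v) := by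
  let S := {s : Fin r × (Fin m → Fin n) //
    Function.Injective s.2 ∧ ∀ j, H s.1 j = 1 ↔ ∃ c, s.2 c = j}
  have hstep : ∀ (c : Fin m) (s : S), ∃ s' : S, s'.1.1 ≠ s.1.1 ∧ s'.1.2 c = s.1.2 c := by
    rintro c ⟨⟨x, σ⟩, -⟩
    obtain ⟨y, hyx, hy⟩ := hH.exists_otherEnd x (σ c)
    obtain ⟨τ, hτ, hc⟩ := hH.exists_frame_apply hy c
    exact ⟨⟨(y, τ), hτ⟩, hyx, hc⟩
  choose step hne heq using hstep
  obtain ⟨σ, hσ⟩ := hH.exists_frame v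
  let F : List (Fin m) → S := List.foldr step ⟨(v, σ), hσ⟩
  exact ⟨{ vert := fun w => (F w).1.1
           edge := fun w => (F w).1.2
           vert_nil := rfl
           edge_injective := fun w => (F w).2.1
           incident_iff := fun w => (F w).2.2
           vert_cons_ne := fun c w => hne c (F w)
           edge_cons := fun c w => heq c (F w) }⟩

namespace TreeCover

variable {v : Fin r} (φ : TreeCover m H v)

theorem edge_treeNeighbor (u : TreeVertex m) (c : Fin m) :
    φ.edge (treeNeighbor u c).1 c = φ.edge u.1 c := by
  rcases treeNeighbor_cases u c with h | h
  · rw [h, φ.edge_cons]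
  · conv_rhs => rw [h, φ.edge_cons]

theorem vert_treeNeighbor_ne (u : TreeVertex m) (c : Fin m) :
    φ.vert (treeNeighbor u c).1 ≠ φ.vert u.1 := by
  rcases treeNeighbor_cases u c with h | h
  · rw [h]
    exact φ.vert_cons_ne _ _
  · rw [h]
    exact (φ.vert_cons_ne _ _).symm

theorem incident_left (u : TreeVertex m) (c : Fin m) : H (φ.vert u.1) (φ.edge u.1 c) = 1 :=
  (φ.incident_iff _ _).2 ⟨c, rfl⟩

theorem incident_right (u : TreeVertex m) (c : Fin m) :
    H (φ.vert (treeNeighbor u c).1) (φ.edge u.1 c) = 1 :=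
  (φ.incident_iff _ _).2 ⟨c, φ.edge_treeNeighbor u c⟩

/-- The covering as a homomorphism of graphs. -/
def hom : regularTree m →g rowGraph H where
  toFun u := φ.vert u.1
  map_rel' {u w} h := by
    obtain ⟨c, rfl⟩ := regularTree_adj_iff.1 h
    exact ⟨(φ.vert_treeNeighbor_ne u c).symm, _, φ.incident_left u c, φ.incident_right u c⟩

theorem hom_apply (u : TreeVertex m) : φ.hom u = φ.vert u.1 := rfl

end TreeCover

/-- In a graph of girth at least `3`, different columns are not equal as vectors. -/
theorem eq_of_col_eq_of_girth (hg : girth H = (m : ℕ∞)) (hm : 3 ≤ m) {j j' : Fin n}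
    (h : ∀ i, H i j = H i j') : j = j' := by
  by_contra hne
  rw [girth, if_pos ⟨j, j', hne, h⟩] at hg
  have : 2 = m := by exact_mod_cast hg
  omega

theorem egirth_rowGraph (hg : girth H = (m : ℕ∞)) (hm : 3 ≤ m) : (rowGraph H).egirth = m := by
  rw [girth, if_neg] at hg
  · exact hg
  · rintro ⟨j, j', hne, h⟩
    exact hne (eq_of_col_eq_of_girth hg hm h)

namespace TreeCover

variable {v : Fin r} (φ : TreeCover m H v)

/-- Local injectivity: neighbours with a common image would produce two columns with the same ends,
which girth at least 3 excludes. -/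
theorem hom_ne_of_ne (hH : IsTwoType m H) (hg : girth H = (m : ℕ∞)) (hm : 3 ≤ m)
    {u w w' : TreeVertex m} (hw : (regularTree m).Adj u w) (hw' : (regularTree m).Adj u w')
    (hne : w ≠ w') : φ.hom w ≠ φ.hom w' := by
  obtain ⟨c, rfl⟩ := regularTree_adj_iff.1 hw
  obtain ⟨d, rfl⟩ := regularTree_adj_iff.1 hw'
  intro h
  have h1 := φ.incident_right u c
  rw [← hom_apply, h] at h1
  refine hne (congrArg _ (φ.edge_injective u.1 (eq_of_col_eq_of_girth hg hm
    (hH.col_eq (φ.vert_treeNeighbor_ne u d) h1 (φ.incident_left u c) (φ.incident_right u d)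
      (φ.incident_left u d)))))

/-- Paths of length less than the girth are mapped to paths. -/
theorem isPath_map (hH : IsTwoType m H) (hg : girth H = (m : ℕ∞)) (hm : 3 ≤ m)
    {u w : TreeVertex m} (p : (regularTree m).Walk u w) (hp : p.IsPath) (hl : p.length < m) :
    (p.map φ.hom).IsPath := by
  induction p with
  | nil => simp
  | @cons u x w h p ih =>
    rw [SimpleGraph.Walk.cons_isPath_iff] at hp
    rw [SimpleGraph.Walk.length_cons] at hl
    have ih := ih hp.1 (by omega)
    rw [SimpleGraph.Walk.map_cons, SimpleGraph.Walk.cons_isPath_iff]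
    refine ⟨ih, fun hmem => ?_⟩
    set q := (p.map φ.hom).takeUntil _ hmem with hq
    have hqp : q.IsPath := ih.takeUntil hmem
    have hql : q.length ≤ p.length :=
      ((p.map φ.hom).length_takeUntil_le_length hmem).trans_eq (SimpleGraph.Walk.length_map _ _)
    -- If the first edge is not on `q`, it closes `q` to a cycle shorter than the girth. If it is,
    -- the image path starts by going back along it, and local injectivity makes the path in the
    -- tree return to `u`.
    by_cases he : s(φ.hom u, φ.hom x) ∈ q.edges
    · have he' : s(φ.hom x, φ.hom u) ∈ (p.map φ.hom).edges := by
        rw [Sym2.eq_swap]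
        exact (p.map φ.hom).edges_takeUntil_subset_edges hmem he
      have hsnd := ih.eq_snd_of_mem_edges he'
      cases p with
      | nil => simp at he'
      | cons h' p =>
        rw [SimpleGraph.Walk.map_cons, SimpleGraph.Walk.snd_cons] at hsnd
        refine φ.hom_ne_of_ne hH hg hm h.symm h' ?_ hsnd
        rintro rfl
        exact hp.2 (by simp)
    · have hc := (SimpleGraph.Walk.cons_isCycle_iff q (φ.hom.map_adj h)).2 ⟨hqp, he⟩
      have := SimpleGraph.egirth_le_length hc
      rw [egirth_rowGraph hg hm, SimpleGraph.Walk.length_cons] at this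
      have : m ≤ q.length + 1 := by exact_mod_cast this
      omega

/-- Two vertices of `T` are joined by a path of length less than the girth; its image is a path, and
a closed path has length zero. -/
theorem injOn_hom (hH : IsTwoType m H) (hg : girth H = (m : ℕ∞)) (hm : 3 ≤ m)
    {T : (regularTree m).Subgraph} {k : ℕ} (hT : T.coe.IsTree) (hk : T.edgeSet.encard = k)
    (hkm : k < m) : Set.InjOn φ.hom T.verts := by
  intro u hu w hw h
  obtain ⟨p, hp, hl⟩ := exists_isPath_length_le hT hk hu hw
  have hq := φ.isPath_map hH hg hm p hp (hl.trans_lt hkm)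
  have := SimpleGraph.Walk.length_eq_zero_iff.2 (hq.nil_iff_eq.2 h)
  rw [SimpleGraph.Walk.length_map] at this
  exact SimpleGraph.Walk.eq_of_length_eq_zero this

end TreeCover

end Cover

/-! ### Components of random subgraphs -/

section Components

variable {m r n : ℕ} {H : Matrix (Fin r) (Fin n) (ZMod 2)}

theorem card_add_colRank_le_of_surjective {K ι : Type*} [Field K] [Fintype ι]
    (H : Matrix (Fin r) (Fin n) K) (e : Finset (Fin n)) {π : Fin r → ι}
    (hπ : Function.Surjective π) (h : ∀ y : ι → K, y ∘ π ∈ leftKer H e) :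
    Fintype.card ι + colRank H e ≤ r := by
  have h1 := LinearMap.finrank_le_finrank_of_injective
    (f := (LinearMap.funLeft K K π).codRestrict (leftKer H e) h)
    fun x y hxy => LinearMap.funLeft_injective_of_surjective K K π hπ (congrArg Subtype.val hxy)
  rw [Module.finrank_fintype_fun_eq_card] at h1
  have h2 := colRank_add_finrank_leftKer H e
  omega

/-- The graph with incidence matrix `H`, restricted to the edges in `e`. -/
def edgeGraph (H : Matrix (Fin r) (Fin n) (ZMod 2)) (e : Finset (Fin n)) :
    SimpleGraph (Fin r) where
  Adj i i' := i ≠ i' ∧ ∃ j ∈ e, H i j = 1 ∧ H i' j = 1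
  symm := ⟨fun _ _ h => ⟨h.1.symm, h.2.imp fun _ hj => ⟨hj.1, hj.2.symm⟩⟩⟩
  loopless := ⟨fun _ h => h.1 rfl⟩

open Classical in
-- A function constant on components is orthogonal to each column in `e`, since its equal values at
-- the two ends cancel in characteristic 2.
theorem IsTwoType.card_connectedComponent_add_colRank_le (hH : IsTwoType m H)
    (e : Finset (Fin n)) :
    Fintype.card (edgeGraph H e).ConnectedComponent + colRank H e ≤ r := by
  refine card_add_colRank_le_of_surjective H e
    (π := (edgeGraph H e).connectedComponentMk) Quot.mk_surjective fun y j hj => ?_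
  obtain ⟨a, b, hab, h⟩ := hH.exists_ends j
  have hadj : (edgeGraph H e).connectedComponentMk a = (edgeGraph H e).connectedComponentMk b :=
    SimpleGraph.ConnectedComponent.sound
      (SimpleGraph.Adj.reachable ⟨hab, j, hj, by simp [h], by simp [h]⟩)
  rw [dotProduct, ← Finset.sum_subset (Finset.subset_univ {a, b}), Finset.sum_pair hab]
  · simp only [Matrix.col_apply, h, Function.comp_apply, hadj, true_or, or_true, if_true, mul_one]
    exact CharTwo.add_self_eq_zero _
  · intro i _ hi
    simp only [Finset.mem_insert, Finset.mem_singleton] at hi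
    rw [Matrix.col_apply, h, if_neg hi, mul_zero]

theorem IsTwoType.rank_add_one_le (hH : IsTwoType m H) (hr : 0 < r) : H.rank + 1 ≤ r := by
  classical
  have h := hH.card_connectedComponent_add_colRank_le Finset.univ
  rw [colRank_univ] at h
  have : 0 < Fintype.card (edgeGraph H Finset.univ).ConnectedComponent :=
    Fintype.card_pos_iff.2 ⟨(edgeGraph H Finset.univ).connectedComponentMk ⟨0, hr⟩⟩
  omega

open Classical in
theorem IsTwoType.mul_eq (hH : IsTwoType m H) : r * m = n * 2 := by
  have h := Finset.card_mul_eq_card_mul (s := (Finset.univ : Finset (Fin r)))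
    (t := (Finset.univ : Finset (Fin n))) (fun i j => H i j ≠ 0) (m := m) (n := 2)
    (fun i _ => (congrArg Finset.card (Finset.filter_congr_decidable _ _ _)).trans (hH.1 i))
    (fun j _ => (congrArg Finset.card (Finset.filter_congr_decidable _ _ _)).trans (hH.2 j))
  rwa [Finset.card_univ, Finset.card_univ, Fintype.card_fin, Fintype.card_fin] at h

namespace TreeCover

variable {v : Fin r} (φ : TreeCover m H v) {T T' : (regularTree m).Subgraph} {k : ℕ}
  {e : Finset (Fin n)}

/-- The subtree `T` is, under the covering, exactly what the edge set `e` cuts out around it. -/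
def Matches (T : (regularTree m).Subgraph) (e : Finset (Fin n)) : Prop :=
  ∀ u ∈ T.verts, ∀ c, T.Adj u (treeNeighbor u c) ↔ φ.edge u.1 c ∈ e

variable {φ}

/-- Walking in `T` from the root, each step crosses an edge lying over `e`, which `T'` must contain
as well. -/
theorem Matches.verts_subset (hT : T.coe.IsTree) (h0 : treeRoot m ∈ T.verts) (h : φ.Matches T e)
    (h0' : treeRoot m ∈ T'.verts) (h' : φ.Matches T' e) : T.verts ⊆ T'.verts := by
  intro x hx
  have hreach := hT.1.1 ⟨treeRoot m, h0⟩ ⟨x, hx⟩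
  rw [SimpleGraph.reachable_iff_reflTransGen] at hreach
  suffices ∀ y : T.verts, Relation.ReflTransGen T.coe.Adj ⟨treeRoot m, h0⟩ y → y.1 ∈ T'.verts from
    this _ hreach
  intro y hy
  induction hy with
  | refl => exact h0'
  | @tail y z _ hyz ih =>
    have hadj : T.Adj y.1 z.1 := hyz
    obtain ⟨c, hc⟩ := regularTree_adj_iff.1 (T.adj_sub hadj)
    rw [← hc] at hadj ⊢
    exact ((h' _ ih c).2 ((h _ y.2 c).1 hadj)).snd_mem

/-- At most one subtree is cut out by a given edge set. -/
theorem Matches.unique (hT : T.coe.IsTree) (h0 : treeRoot m ∈ T.verts) (h : φ.Matches T e)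
    (hT' : T'.coe.IsTree) (h0' : treeRoot m ∈ T'.verts) (h' : φ.Matches T' e) : T = T' := by
  have hv : T.verts = T'.verts :=
    (h.verts_subset hT h0 h0' h').antisymm (h'.verts_subset hT' h0' h0 h)
  refine SimpleGraph.Subgraph.ext hv (funext fun u => funext fun w => propext ?_)
  constructor
  · intro hadj
    obtain ⟨c, rfl⟩ := regularTree_adj_iff.1 (T.adj_sub hadj)
    exact (h' u (hv ▸ hadj.fst_mem) c).2 ((h u hadj.fst_mem c).1 hadj)
  · intro hadj
    obtain ⟨c, rfl⟩ := regularTree_adj_iff.1 (T'.adj_sub hadj)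
    exact (h u (hv ▸ hadj.fst_mem) c).2 ((h' u hadj.fst_mem c).1 hadj)

/-- The component of the base vertex is covered by a subtree that is cut out. -/
theorem Matches.exists_of_reachable (hH : IsTwoType m H) (h0 : treeRoot m ∈ T.verts)
    (h : φ.Matches T e) {x : Fin r} (hx : (edgeGraph H e).Reachable v x) :
    ∃ u ∈ T.verts, φ.vert u.1 = x := by
  rw [SimpleGraph.reachable_iff_reflTransGen] at hx
  induction hx with
  | refl => exact ⟨_, h0, φ.vert_nil⟩
  | @tail y z _ hyz ih =>
    obtain ⟨u, hu, rfl⟩ := ih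
    obtain ⟨hne, j, hj, hyj, hzj⟩ := hyz
    obtain ⟨c, rfl⟩ := (φ.incident_iff _ _).1 hyj
    refine ⟨_, ((h u hu c).2 hj).snd_mem, ?_⟩
    exact ((hH.eq_or_eq hne hyj hzj (φ.incident_right u c)).resolve_left
      (φ.vert_treeNeighbor_ne u c))

open Classical in
theorem Matches.card_component_le (hH : IsTwoType m H) (hT : T.coe.IsTree)
    (hk : T.edgeSet.encard = k) (h0 : treeRoot m ∈ T.verts) (h : φ.Matches T e) :
    (Finset.univ.filter fun x => (edgeGraph H e).connectedComponentMk x =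
      (edgeGraph H e).connectedComponentMk v).card ≤ k + 1 := by
  obtain ⟨V, hV, hcard⟩ := exists_verts_finset hT hk h0
  rw [← hcard]
  refine (Finset.card_le_card fun x hx => ?_).trans
    (Finset.card_image_le (s := V) (f := fun u => φ.vert u.1))
  obtain ⟨u, hu, hux⟩ := h.exists_of_reachable hH h0
    (SimpleGraph.ConnectedComponent.exact (Finset.mem_filter.1 hx).2).symm
  exact Finset.mem_image.2 ⟨u, (hV u).2 hu, hux⟩

variable (φ)

/-- The columns required to lie in `e` and those required to avoid it are disjoint. A column below
an edge of `T` has its ends below that edge only, by injectivity on `T`, so a half-edge at `w` over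
the same column belongs to `T`. -/
theorem edge_ne_edge (hH : IsTwoType m H) (hg : girth H = (m : ℕ∞))
    (hT : T.coe.IsTree) (hk : T.edgeSet.encard = k) (hkm : k ≤ m - 2)
    {u w : TreeVertex m} {c d : Fin m} (hu : T.Adj u (treeNeighbor u c)) (hw : w ∈ T.verts)
    (hwd : ¬ T.Adj w (treeNeighbor w d)) : φ.edge u.1 c ≠ φ.edge w.1 d := by
  intro heq
  -- With `hkm` this forces m ≥ 3, as injectivity of the covering on `T` requires.
  have hk0 : k ≠ 0 := by
    rintro rfl
    have h := Set.encard_eq_zero.1 (hk.trans (by simp))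
    have : s(u, treeNeighbor u c) ∈ T.edgeSet := SimpleGraph.Subgraph.mem_edgeSet.2 hu
    rw [h] at this
    exact this
  have hinj := φ.injOn_hom hH hg (by omega) hT hk (by omega)
  have hinc := φ.incident_left w d
  rw [← heq] at hinc
  rcases hH.eq_or_eq (φ.vert_treeNeighbor_ne u c).symm (φ.incident_left u c)
    (φ.incident_right u c) hinc with h | h
  · obtain rfl := hinj hw hu.fst_mem h
    exact hwd (φ.edge_injective _ heq ▸ hu)
  · obtain rfl := hinj hw hu.snd_mem h
    rw [← φ.edge_treeNeighbor] at heq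
    rw [← φ.edge_injective _ heq, treeNeighbor_treeNeighbor] at hwd
    exact hwd hu.symm

open Classical in
-- Each edge of `T` is charged to its end farther from the root, whose first letter is the colour of
-- the edge; there are `k` vertices other than the root.
theorem card_image_edge_le
    (h0 : treeRoot m ∈ T.verts) {V : Finset (TreeVertex m)} (hV : ∀ x, x ∈ V ↔ x ∈ T.verts)
    (hcard : V.card = k + 1) :
    (((V ×ˢ (Finset.univ : Finset (Fin m))).filter
      fun x => T.Adj x.1 (treeNeighbor x.1 x.2)).image fun x => φ.edge x.1.1 x.2).card ≤ k := by
  have hc : (V.erase (treeRoot m)).card = k := by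
    rw [Finset.card_erase_of_mem ((hV _).2 h0), hcard, Nat.add_sub_cancel]
  rw [← hc]
  refine Finset.card_le_card_of_forall_subsingleton
    (fun j w => ∃ c l, w.1 = c :: l ∧ φ.edge w.1 c = j) ?_ ?_
  · intro j hj
    obtain ⟨⟨u, c⟩, hx, rfl⟩ := Finset.mem_image.1 hj
    have hadj : T.Adj u (treeNeighbor u c) := (Finset.mem_filter.1 hx).2
    have hne : ∀ w : TreeVertex m, ∀ l, w.1 = c :: l → w ≠ treeRoot m := by
      rintro w l hw rfl
      exact List.cons_ne_nil _ _ hw.symm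
    rcases treeNeighbor_cases u c with h | h
    · exact ⟨_, Finset.mem_erase.2 ⟨hne _ _ h, (hV _).2 hadj.snd_mem⟩, c, _, h,
        φ.edge_treeNeighbor u c⟩
    · exact ⟨_, Finset.mem_erase.2 ⟨hne _ _ h, (hV _).2 hadj.fst_mem⟩, c, _, h, rfl⟩
  · rintro w _ j ⟨_, c, l, h, rfl⟩ j' ⟨_, c', l', h', rfl⟩
    rw [(List.cons.inj (h.symm.trans h')).1]

open Classical in
/-- The probability that a given subtree is cut out by a random edge set. -/
theorem le_bernoulliSum_matches (hH : IsTwoType m H) (hg : girth H = (m : ℕ∞)) (hm : 2 ≤ m)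
    (hT : T.coe.IsTree) (hk : T.edgeSet.encard = k) (h0 : treeRoot m ∈ T.verts)
    (hkm : k ≤ m - 2) {p : ℝ} (hp0 : 0 ≤ p) (hp1 : p ≤ 1) :
    p ^ k * (1 - p) ^ (m + (m - 2) * k) ≤
      bernoulliSum Finset.univ p (fun e => if φ.Matches T e then 1 else 0) := by
  obtain ⟨V, hV, hcard⟩ := exists_verts_finset hT hk h0
  set I := (V ×ˢ (Finset.univ : Finset (Fin m))).filter
    fun x => T.Adj x.1 (treeNeighbor x.1 x.2) with hI
  set B := (V ×ˢ (Finset.univ : Finset (Fin m))).filter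
    fun x => ¬ T.Adj x.1 (treeNeighbor x.1 x.2) with hB
  have hIB : I.card + B.card = (k + 1) * m := by
    rw [hI, hB, Finset.card_filter_add_card_filter_not, Finset.card_product, hcard,
      Finset.card_univ, Fintype.card_fin]
  have hIcard : 2 * k ≤ I.card := two_mul_le_card_halfEdges hT hk hV h0
  -- Here (k + 1)m - 2k = m + (m - 2)k.
  have hBcard : B.card ≤ m + (m - 2) * k := by
    obtain ⟨l, rfl⟩ := Nat.exists_eq_add_of_le hm
    rw [Nat.add_sub_cancel_left]
    nlinarith
  let f : TreeVertex m × Fin m → Fin n := fun x => φ.edge x.1.1 x.2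
  have hdisj : Disjoint (I.image f) (B.image f) := by
    rw [Finset.disjoint_left]
    intro j hj hj'
    obtain ⟨x, hx, rfl⟩ := Finset.mem_image.1 hj
    obtain ⟨y, hy, hxy⟩ := Finset.mem_image.1 hj'
    rw [hI, Finset.mem_filter] at hx
    rw [hB, Finset.mem_filter, Finset.mem_product] at hy
    exact φ.edge_ne_edge hH hg hT hk hkm hx.2 ((hV _).1 hy.1.1) hy.2 hxy.symm
  have hmatch : ∀ e, φ.Matches T e ↔ I.image f ⊆ e ∧ Disjoint (B.image f) e := by
    intro e
    simp only [Finset.image_subset_iff, Finset.disjoint_left, Finset.forall_mem_image, hI, hB,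
      Finset.mem_filter, Finset.mem_product, hV, Finset.mem_univ, and_true, Prod.forall, f,
      Matches]
    grind
  simp only [hmatch]
  rw [bernoulliSum_contains_avoids p hdisj]
  -- Half-edges may lie over the same column. This only raises the probability, so upper bounds on
  -- both numbers of columns suffice.
  refine mul_le_mul (pow_le_pow_of_le_one hp0 hp1 (φ.card_image_edge_le h0 hV hcard))
    (pow_le_pow_of_le_one (by linarith) (by linarith) (Finset.card_image_le.trans hBcard))
    (pow_nonneg (by linarith) _) (pow_nonneg hp0 _)

end TreeCover

theorem exists_finset_subtrees (m k : ℕ) :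
    ∃ A : Finset (regularTree m).Subgraph, A.card = subtreeCount m k ∧
      ∀ T ∈ A, treeRoot m ∈ T.verts ∧ T.coe.IsTree ∧ T.edgeSet.encard = k := by
  by_cases h : {T : (regularTree m).Subgraph |
    treeRoot m ∈ T.verts ∧ T.coe.IsTree ∧ T.edgeSet.encard = k}.Finite
  · exact ⟨h.toFinset, (Set.ncard_eq_toFinset_card _ h).symm, fun T hT => h.mem_toFinset.1 hT⟩
  -- `Set.ncard` is 0 on infinite sets, so finiteness of the family of subtrees need not be proved.
  · exact ⟨∅, (Set.Infinite.ncard h).symm, by simp⟩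

open Classical in
-- The vertices of each component contribute 1 in total.
theorem sum_inv_card_component (e : Finset (Fin n)) :
    ∑ v, ((Finset.univ.filter fun x => (edgeGraph H e).connectedComponentMk x =
      (edgeGraph H e).connectedComponentMk v).card : ℝ)⁻¹ =
      Fintype.card (edgeGraph H e).ConnectedComponent := by
  rw [← Finset.sum_fiberwise Finset.univ (edgeGraph H e).connectedComponentMk,
    ← Finset.card_univ, ← nsmul_one, ← Finset.sum_const]
  refine Finset.sum_congr rfl fun c _ => ?_
  rw [Finset.sum_congr rfl fun v hv => by rw [(Finset.mem_filter.1 hv).2], Finset.sum_const,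
    nsmul_eq_mul, mul_inv_cancel₀]
  obtain ⟨v, hv⟩ := c.exists_rep
  exact Nat.cast_ne_zero.2 (Finset.card_ne_zero_of_mem (a := v)
    (Finset.mem_filter.2 ⟨Finset.mem_univ v, hv⟩))

open Classical in
/-- The expected inverse size of the component of a vertex is at least the contribution of the
components with at most `m - 2` edges. -/
theorem le_bernoulliSum_inv_card_component (hH : IsTwoType m H) (hg : girth H = (m : ℕ∞))
    (hm : 2 ≤ m) {p : ℝ} (hp0 : 0 ≤ p) (hp1 : p ≤ 1) (v : Fin r) :
    (1 - p) ^ m * truncatedSeries m (m - 2) (p * (1 - p) ^ (m - 2)) ≤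
      bernoulliSum Finset.univ p (fun e =>
        ((Finset.univ.filter fun x => (edgeGraph H e).connectedComponentMk x =
          (edgeGraph H e).connectedComponentMk v).card : ℝ)⁻¹) := by
  obtain ⟨φ⟩ := hH.nonempty_treeCover v
  choose A hA hAT using exists_finset_subtrees m
  -- At most one subtree matches `e`, so the sum has at most one nonzero term. The matching subtree
  -- covers the component of `v`, which therefore has at most k + 1 vertices.
  have hpt : ∀ e, ∑ x ∈ (Finset.range (m - 2 + 1)).sigma A,
      ((x.1 : ℝ) + 1)⁻¹ * (if φ.Matches x.2 e then 1 else 0) ≤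
        ((Finset.univ.filter fun x => (edgeGraph H e).connectedComponentMk x =
          (edgeGraph H e).connectedComponentMk v).card : ℝ)⁻¹ := by
    intro e
    by_cases hex : ∃ x ∈ (Finset.range (m - 2 + 1)).sigma A, φ.Matches x.2 e
    · obtain ⟨⟨k, T⟩, hx, hmatch⟩ := hex
      obtain ⟨h0, hT, hk⟩ := hAT k T (Finset.mem_sigma.1 hx).2
      rw [Finset.sum_eq_single_of_mem _ hx, if_pos hmatch, mul_one]
      · have h1 := hmatch.card_component_le hH hT hk h0
        have h2 : 0 < (Finset.univ.filter fun x => (edgeGraph H e).connectedComponentMk x =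
          (edgeGraph H e).connectedComponentMk v).card :=
          Finset.card_pos.2 ⟨v, by simp⟩
        exact inv_anti₀ (by exact_mod_cast h2) (by exact_mod_cast h1)
      · rintro ⟨k', T'⟩ hx' hne
        obtain ⟨h0', hT', hk'⟩ := hAT k' T' (Finset.mem_sigma.1 hx').2
        rw [if_neg, mul_zero]
        intro hmatch'
        obtain rfl := hmatch.unique hT h0 hT' h0' hmatch'
        rw [hk] at hk'
        obtain rfl : k = k' := by exact_mod_cast hk'
        exact hne rfl
    · rw [Finset.sum_eq_zero]
      · positivity
      · intro x hx
        rw [if_neg fun h => hex ⟨x, hx, h⟩, mul_zero]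
  refine le_trans ?_ (bernoulliSum_mono hp0 hp1 hpt)
  rw [bernoulliSum_sum, Finset.sum_sigma, truncatedSeries, Finset.mul_sum]
  refine Finset.sum_le_sum fun k hk => ?_
  calc _ = ∑ T ∈ A k, ((k : ℝ) + 1)⁻¹ * (p ^ k * (1 - p) ^ (m + (m - 2) * k)) := by
        rw [Finset.sum_const, hA, nsmul_eq_mul, mul_pow, ← pow_mul, pow_add]
        ring
    _ ≤ _ := by
        refine Finset.sum_le_sum fun T hT => ?_
        obtain ⟨h0, hT, hk'⟩ := hAT k T hT
        rw [bernoulliSum_const_mul]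
        exact mul_le_mul_of_nonneg_left (φ.le_bernoulliSum_matches hH hg hm hT hk' h0
          (Nat.lt_succ_iff.1 (Finset.mem_range.1 hk)) hp0 hp1) (by positivity)

/-- The expected rank of a random set of columns. -/
theorem bernoulliSum_colRank_le (hH : IsTwoType m H) (hg : girth H = (m : ℕ∞))
    (hm : 2 ≤ m) {p : ℝ} (hp0 : 0 ≤ p) (hp1 : p ≤ 1) :
    bernoulliSum Finset.univ p (fun e => (colRank H e : ℝ)) ≤
      r * (1 - (1 - p) ^ m * truncatedSeries m (m - 2) (p * (1 - p) ^ (m - 2))) := by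
  classical
  have h1 := Finset.sum_le_sum fun v (_ : v ∈ Finset.univ) =>
    le_bernoulliSum_inv_card_component hH hg hm hp0 hp1 v
  rw [← bernoulliSum_sum, Finset.sum_const, Finset.card_univ, Fintype.card_fin, nsmul_eq_mul] at h1
  simp only [sum_inv_card_component] at h1
  have h2 : bernoulliSum Finset.univ p (fun e => (colRank H e : ℝ)) ≤
      bernoulliSum Finset.univ p (fun e =>
        (r : ℝ) - Fintype.card (edgeGraph H e).ConnectedComponent) := by
    refine bernoulliSum_mono hp0 hp1 fun e => ?_
    have : (Fintype.card (edgeGraph H e).ConnectedComponent : ℝ) + colRank H e ≤ r := by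
      exact_mod_cast hH.card_connectedComponent_add_colRank_le e
    linarith
  rw [bernoulliSum_sub, bernoulliSum_const] at h2
  linarith

end Components

/-! ### The bound on the rate -/

theorem two_le_of_girth_eq {r n m : ℕ} {H : Matrix (Fin r) (Fin n) (ZMod 2)}
    (hg : girth H = (m : ℕ∞)) : 2 ≤ m := by
  rw [girth] at hg
  split_ifs at hg with h
  · have : 2 = m := by exact_mod_cast hg
    exact this.le
  · have := SimpleGraph.three_le_egirth (G := rowGraph H)
    rw [hg] at this
    have : 3 ≤ m := by exact_mod_cast this
    omega

namespace CSSCode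

variable {C : CSSCode} {m : ℕ}

theorem IsProper.two_le (hC : C.IsProper m) : 2 ≤ m := two_le_of_girth_eq hC.2.2.1

theorem IsProper.rX_pos (hC : C.IsProper m) : 0 < C.rX :=
  Fin.pos_iff_nonempty.2 hC.2.1.nonempty

theorem IsProper.rZ_pos (hC : C.IsProper m) : 0 < C.rZ :=
  Fin.pos_iff_nonempty.2 hC.2.2.2.1.nonempty

theorem IsProper.n_pos (hC : C.IsProper m) : 0 < C.n := by
  have h1 := hC.1.1.mul_eq
  have h2 := Nat.mul_pos hC.rX_pos (zero_lt_two.trans_le hC.two_le)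
  omega

theorem totalRank_mono : Monotone C.totalRank := fun _ _ h =>
  Nat.add_le_add (colRank_mono C.HX h) (colRank_mono C.HZ h)

theorem totalRank_univ : C.totalRank Finset.univ = C.HX.rank + C.HZ.rank := by
  rw [totalRank, colRank_univ, colRank_univ]

theorem concaveOn_totalRank (C : CSSCode) : ConcaveOn ℝ (Set.Icc 0 1)
    (fun p => bernoulliSum Finset.univ p fun e => (C.totalRank e : ℝ)) := by
  simp only [totalRank, Nat.cast_add, bernoulliSum_add]
  exact (concaveOn_bernoulliSum _ (colRank_insert_sub_antitone C.HX)).add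
    (concaveOn_bernoulliSum _ (colRank_insert_sub_antitone C.HZ))

theorem IsProper.bernoulliSum_totalRank_le (hC : C.IsProper m) {p : ℝ} (hp0 : 0 ≤ p)
    (hp1 : p ≤ 1) :
    bernoulliSum Finset.univ p (fun e => (C.totalRank e : ℝ)) ≤
      4 * C.n / m *
        (1 - (1 - p) ^ m * truncatedSeries m (m - 2) (p * (1 - p) ^ (m - 2))) := by
  have hm : (0 : ℝ) < m := Nat.cast_pos.2 (zero_lt_two.trans_le hC.two_le)
  have hX : (C.rX : ℝ) * m = C.n * 2 := by exact_mod_cast hC.1.1.mul_eq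
  have hZ : (C.rZ : ℝ) * m = C.n * 2 := by exact_mod_cast hC.1.2.mul_eq
  have h1 := bernoulliSum_colRank_le hC.1.1 hC.2.2.1 hC.two_le hp0 hp1
  have h2 := bernoulliSum_colRank_le hC.1.2 hC.2.2.2.2 hC.two_le hp0 hp1
  have h3 : 4 * (C.n : ℝ) / m = C.rX + C.rZ := by
    rw [div_eq_iff hm.ne']
    linarith
  simp only [totalRank, Nat.cast_add, bernoulliSum_add]
  rw [h3, add_mul]
  exact add_le_add h1 h2

open Classical in
/-- The expected deficiency of the no-cloning relation between the ranks of the erased and of the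
remaining columns. -/
theorem expected_rank_relation (C : CSSCode) (D : C.Decoder) {p : ℝ} (hp0 : 0 ≤ p) (hp1 : p ≤ 1) :
    2 * (C.n * p) + bernoulliSum Finset.univ (1 - p) (fun e => (C.totalRank e : ℝ)) ≤
      bernoulliSum Finset.univ p (fun e => (C.totalRank e : ℝ)) + C.totalRank Finset.univ +
        4 * C.n * C.errorProb D p := by
  have hpt : ∀ e : Finset (Fin C.n),
      2 * (e.card : ℝ) + C.totalRank eᶜ ≤ (C.totalRank e + C.totalRank Finset.univ) +
        2 * C.n * (if C.Correctable e then 0 else 1) := by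
    intro e
    split_ifs with h
    · have : 2 * (e.card : ℝ) + C.totalRank eᶜ ≤ C.totalRank e + C.totalRank Finset.univ := by
        exact_mod_cast h.le_totalRank
      linarith
    -- For uncorrectable `e` the penalty 2n absorbs 2|e|, and monotonicity of rank does the rest.
    · have h1 : (e.card : ℝ) ≤ C.n := by
        exact_mod_cast (Finset.card_le_univ e).trans_eq (Fintype.card_fin _)
      have h2 : (C.totalRank eᶜ : ℝ) ≤ C.totalRank Finset.univ := by
        exact_mod_cast totalRank_mono (Finset.subset_univ eᶜ)
      have h3 : (0 : ℝ) ≤ C.totalRank e := Nat.cast_nonneg _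
      linarith
  have h := bernoulliSum_mono (s := Finset.univ) hp0 hp1 hpt
  simp only [bernoulliSum_add, bernoulliSum_const_mul, bernoulliSum_card, bernoulliSum_const,
    Finset.card_univ, Fintype.card_fin] at h
  rw [bernoulliSum_compl p fun e => (C.totalRank e : ℝ)] at h
  have h4 := mul_le_mul_of_nonneg_left (C.bernoulliSum_not_correctable_le D hp0 hp1)
    (by positivity : (0 : ℝ) ≤ 2 * C.n)
  linarith

theorem IsProper.rate_le (hC : C.IsProper m) (D : C.Decoder) {p : ℝ} (hp0 : 0 < p)
    (hp : p ≤ 1 / 2) :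
    C.rate ≤ (1 - 2 * p) * (4 / ((m : ℝ) * p) *
      (1 - (1 - p) ^ m * truncatedSeries m (m - 2) (p * (1 - p) ^ (m - 2))) - 1) +
        4 * (1 - p) / p * C.errorProb D p := by
  have hn : (0 : ℝ) < C.n := Nat.cast_pos.2 hC.n_pos
  have hm : (0 : ℝ) < m := Nat.cast_pos.2 (zero_lt_two.trans_le hC.two_le)
  have hq : 0 < 1 - p := by linarith
  have h1 := C.expected_rank_relation D hp0.le (by linarith)
  have h2 := hC.bernoulliSum_totalRank_le hp0.le (by linarith)
  -- The weights p/(1 - p) and (1 - 2p)/(1 - p) express 1 - p as a convex combination of p and 1.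
  have h3 := C.concaveOn_totalRank.2 (⟨hp0.le, by linarith⟩ : p ∈ Set.Icc (0 : ℝ) 1)
    (⟨zero_le_one, le_rfl⟩ : (1 : ℝ) ∈ Set.Icc (0 : ℝ) 1) (div_nonneg hp0.le hq.le)
    (div_nonneg (by linarith) hq.le : 0 ≤ (1 - 2 * p) / (1 - p)) (by field_simp; ring)
  have h4 : p / (1 - p) * p + (1 - 2 * p) / (1 - p) * 1 = 1 - p := by
    field_simp
    ring
  simp only [smul_eq_mul, h4, bernoulliSum_one_prob] at h3
  have h5 : C.rate * C.n = C.n - C.totalRank Finset.univ := by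
    rw [rate, div_mul_cancel₀ _ hn.ne', totalRank_univ]
    push_cast
    ring
  generalize bernoulliSum Finset.univ p (fun e => (C.totalRank e : ℝ)) = ρ at h1 h2 h3
  generalize bernoulliSum Finset.univ (1 - p) (fun e => (C.totalRank e : ℝ)) = ρ' at h1 h3
  generalize 1 - (1 - p) ^ m * truncatedSeries m (m - 2) (p * (1 - p) ^ (m - 2)) = S at h2 ⊢
  -- From here `k` is the total rank n(1 - rate), not the dimension of the code.
  generalize (C.totalRank Finset.univ : ℝ) = k at h1 h3 h5
  generalize C.errorProb D p = ε at h1 ⊢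
  have h6 : p * ρ + (1 - 2 * p) * k ≤ (1 - p) * ρ' := by
    have := mul_le_mul_of_nonneg_left h3 hq.le
    have h7 : (1 - p) * (p / (1 - p) * ρ + (1 - 2 * p) / (1 - p) * k) =
        p * ρ + (1 - 2 * p) * k := by
      field_simp
    rwa [h7] at this
  have h8 := mul_le_mul_of_nonneg_left h1 hq.le
  have h9 := mul_le_mul_of_nonneg_left h2 (by linarith : 0 ≤ 1 - 2 * p)
  have h10 : C.rate * C.n * p ≤ (1 - 2 * p) * (4 * C.n / m * S - C.n * p) +
      4 * (1 - p) * C.n * ε := by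
    rw [h5]
    nlinarith
  refine le_of_mul_le_mul_right (h10.trans_eq' ?_ |>.trans_eq ?_) (mul_pos hn hp0)
  · ring
  · field_simp

/-- Each rank is at most 2n/m - 1, so the total is at most 4n/m - 2 < n; the lost units give
strictness at m = 4. -/
theorem IsProper.totalRank_univ_lt (hC : C.IsProper m) (hm : 4 ≤ m) :
    C.totalRank Finset.univ < C.n := by
  have h1 := hC.1.1.rank_add_one_le hC.rX_pos
  have h2 := hC.1.2.rank_add_one_le hC.rZ_pos
  have h3 := hC.1.1.mul_eq
  have h4 := hC.1.2.mul_eq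
  have h5 := Nat.mul_le_mul_left C.rX hm
  have h6 := Nat.mul_le_mul_left C.rZ hm
  rw [totalRank_univ]
  omega

open Classical in
/-- No cloning: a code of positive dimension cannot correct the erasures of a channel of erasure
probability at least `1 / 2`. -/
theorem quarter_le_errorProb (hC : C.totalRank Finset.univ < C.n) (D : C.Decoder) {p : ℝ}
    (hp : 1 / 2 ≤ p) (hp1 : p ≤ 1) : 1 / 4 ≤ C.errorProb D p := by
  let f : Finset (Fin C.n) → ℝ := fun e => if C.Correctable e then 1 else 0
  have hf : Antitone f := by
    intro e e' h
    simp only [f]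
    split_ifs with h1 h2 h2
    · exact le_rfl
    · exact absurd (h1.anti h) h2
    · exact zero_le_one
    · exact le_rfl
  have hpt : ∀ e, f e + f eᶜ ≤ 1 := by
    intro e
    simp only [f]
    split_ifs with h1 h2
    · have h3 := h1.le_totalRank
      have h4 := h2.le_totalRank
      have h5 := Finset.card_add_card_compl e
      rw [compl_compl] at h4
      rw [Fintype.card_fin] at h5
      omega
    all_goals norm_num
  -- At probability 1/2 a random set and its complement have the same law, so it is correctable with
  -- probability at most 1/2; antitonicity extends this to larger `p`.
  have h1 := bernoulliSum_mono (s := Finset.univ) (p := 1 / 2) (by norm_num) (by norm_num) hpt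
  rw [bernoulliSum_add, bernoulliSum_const, bernoulliSum_compl _ f,
    (by norm_num : (1 : ℝ) - 1 / 2 = 1 / 2)] at h1
  have h2 := antitoneOn_bernoulliSum Finset.univ hf ⟨by norm_num, by norm_num⟩
    ⟨by linarith, hp1⟩ hp
  have h3 := C.bernoulliSum_not_correctable_le D (by linarith) hp1
  have h4 : bernoulliSum Finset.univ p (fun e => if C.Correctable e then (0 : ℝ) else 1) =
      1 - bernoulliSum Finset.univ p f := by
    refine Eq.trans ?_ (congrArg (· - bernoulliSum Finset.univ p f)
      (bernoulliSum_const (Finset.univ : Finset (Fin C.n)) p 1))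
    rw [← bernoulliSum_sub]
    refine bernoulliSum_congr fun e _ => ?_
    simp only [f]
    split_ifs <;> norm_num
  simp only at h2
  linarith

end CSSCode

end CSSErasure

theorem mainTheorem5 (m : ℕ) (p R : ℝ) (hp0 : 0 < p) (hp1 : p ≤ 1)
    (hpm : p ≤ 1 / 2 ∨ 4 ≤ m) (hR : CSSErasure.Achievable m p R) :
    R ≤ (1 - 2 * p) * (4 / ((m : ℝ) * p) *
      (1 - (1 - p) ^ m *
        CSSErasure.truncatedSeries m (m - 2) (p * (1 - p) ^ (m - 2))) - 1) := by
  obtain ⟨C, D, hC, hrate, herr⟩ := hR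
  rcases le_or_gt p (1 / 2) with hp | hp
  · have h := (herr.const_mul (4 * (1 - p) / p)).const_add ((1 - 2 * p) * (4 / ((m : ℝ) * p) *
      (1 - (1 - p) ^ m *
        CSSErasure.truncatedSeries m (m - 2) (p * (1 - p) ^ (m - 2))) - 1))
    rw [mul_zero, add_zero] at h
    exact le_of_tendsto_of_tendsto' hrate h fun t => (hC t).rate_le (D t) hp0 hp
  · have hm := hpm.resolve_left hp.not_ge
    have := ge_of_tendsto' herr fun t =>
      CSSErasure.CSSCode.quarter_le_errorProb ((hC t).totalRank_univ_lt hm) (D t) hp.le hp1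
    norm_num at this
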